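/- **Circuits.** A quantum circuit with $n$ input bits has a finite set of qubits; $n$ of them are initialised to the input $y\in\mathbb F_2^n$ and all others (ancillas) to $|0\rangle$. It consists of a sequence of layers; a layer is a collection of gates acting on pairwise disjoint sets of qubits, and a gate is an arbitrary one-qubit unitary, an arbitrary two-qubit unitary, or a parity gate $|x_1,\dots,x_r\rangle|b\rangle\mapsto|x_1,\dots,x_r\rangle|b\oplus x_1\oplus\cdots\oplus x_r\rangle$ of unbounded fan-in $r$. At the end all qubits are measured in the computational basis and the output is read off some designated qubits. A family $(\mathcal C_n)_{n\in\mathbb N}$, where $\mathcal C_n$ has $n$ input bits, is a family of $\mathrm{QNC}^0[\oplus]$ circuits if the number of layers of $\mathcal C_n$ is bounded by a constant and the number of qubits and gates of $\mathcal C_n$ is bounded by a polynomial in $n$. **Hadamard code.** For $n=2^k$, let $H:\mathbb F_2^k\to\mathbb F_2^n$, $H(x)=(\langle x,u\rangle)_{u\in\mathbb F_2^k}$, and let $d$ denote the Hamming distance on $\mathbb F_2^n$. **Statement.** There are a family $(\mathcal C_n)_{n\in\mathbb N}$ of $\mathrm{QNC}^0[\oplus]$ circuits and a constant $K>0$ such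 that the following holds. Let $k\in\mathbb N$, $n=2^k$ and $\varepsilon\in[1/\sqrt n,\,1/2]$. Then there are a list length $m=m(k,\varepsilon)\le K\varepsilon^{-2}\log(1/\varepsilon)$ and a choice, depending only on $k$ and $\varepsilon$, of $mk$ distinct output qubits of $\mathcal C_n$, from which a list $L(y)$ of $m$ messages in $\mathbb F_2^k$ is read, such that for every input $y\in\mathbb F_2^n$, with probability at least $1-\varepsilon$ over the measurement outcome of $\mathcal C_n$ on $y$, the list $L(y)$ contains every $x\in\mathbb F_2^k$ with $$d\big(y,H(x)\big)\le\Big(\frac12-\varepsilon\Big)n .$$ -/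

import Mathlib

/-- A pure state of qubits on the wires `W`: the amplitude of each computational basis vector. -/
abbrev QState (W : Type) : Type := (W → ZMod 2) → ℂ

/-- The gates of `QNC⁰[⊕]` circuits on the wires `W`: arbitrary one-qubit and two-qubit unitary
gates, and parity gates of unbounded fan-in. -/
inductive QGate (W : Type) : Type
  | one (i : W) (U : Matrix.unitaryGroup (ZMod 2) ℂ) : QGate W
  | two (i j : W) (hij : i ≠ j) (U : Matrix.unitaryGroup (ZMod 2 × ZMod 2) ℂ) : QGate W
  | parity (S : Finset W) (t : W) (ht : t ∉ S) : QGate W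

/-- The set of wires touched by a gate. -/
def QGate.support {W : Type} [DecidableEq W] : QGate W → Finset W
  | .one i _ => {i}
  | .two i j _ _ => {i, j}
  | .parity S t _ => insert t S

/-- The action of a gate on states. A one-qubit or two-qubit gate acts by its unitary matrix on the
named qubits and trivially on the others. The parity gate with inputs `S` and target `t` is the
permutation of basis vectors that replaces `x t` by `x t ⊕ ⨁ i ∈ S, x i`
(this permutation is its own inverse). -/
noncomputable def QGate.apply {W : Type} [DecidableEq W] : QGate W → QState W → QState W
  | .one i U, ψ => fun x =>
      ∑ a : ZMod 2, (U : Matrix (ZMod 2) (ZMod 2) ℂ) (x i) a * ψ (Function.update x i a)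
  | .two i j _ U, ψ => fun x =>
      ∑ a : ZMod 2 × ZMod 2,
        (U : Matrix (ZMod 2 × ZMod 2) (ZMod 2 × ZMod 2) ℂ) (x i, x j) a *
          ψ (Function.update (Function.update x i a.1) j a.2)
  | .parity S t _, ψ => fun x => ψ (Function.update x t (x t + ∑ i ∈ S, x i))

/-- A layer: gates that act on pairwise disjoint sets of wires, so that they can be executed
simultaneously (and the order of the list is immaterial). -/
structure QLayer (W : Type) [DecidableEq W] : Type where
  gates : List (QGate W)
  disjoint : gates.Pairwise fun g h => Disjoint g.support h.support

/-- The action of a layer on states. -/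
noncomputable def QLayer.apply {W : Type} [DecidableEq W] (L : QLayer W) (ψ : QState W) :
    QState W :=
  L.gates.foldl (fun φ g => g.apply φ) ψ

/-- A quantum circuit with `n` input bits: a finite set of wires, `n` distinct ones of which carry
the input while the others are ancillas, and a sequence of layers of one-qubit gates, two-qubit
gates and unbounded fan-in parity gates. -/
structure QCircuit (n : ℕ) : Type 1 where
  Wire : Type
  [fintypeWire : Fintype Wire]
  [decEqWire : DecidableEq Wire]
  input : Fin n ↪ Wire
  layers : List (QLayer Wire)

attribute [instance] QCircuit.fintypeWire QCircuit.decEqWire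

/-- The number of layers. -/
def QCircuit.depth {n : ℕ} (C : QCircuit n) : ℕ := C.layers.length

/-- The size of a circuit: its number of wires plus its number of gates. -/
def QCircuit.size {n : ℕ} (C : QCircuit n) : ℕ :=
  Fintype.card C.Wire + (C.layers.map fun L => L.gates.length).sum

/-- The initial basis vector on input `y`: the input wires carry `y`, all ancillas carry `0`. -/
noncomputable def QCircuit.initBasis {n : ℕ} (C : QCircuit n) (y : Fin n → ZMod 2) :
    C.Wire → ZMod 2 :=
  Function.extend C.input y fun _ => 0

/-- The final state of the circuit on input `y`. -/
noncomputable def QCircuit.finalState {n : ℕ} (C : QCircuit n) (y : Fin n → ZMod 2) :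
    QState C.Wire :=
  C.layers.foldl (fun φ L => L.apply φ) (Pi.single (C.initBasis y) 1)

open Classical in
/-- The probability that, on input `y`, measuring all wires of the final state in the computational
basis gives an outcome in `E`. -/
noncomputable def QCircuit.prob {n : ℕ} (C : QCircuit n) (y : Fin n → ZMod 2)
    (E : Set (C.Wire → ZMod 2)) : ℝ :=
  ∑ z : C.Wire → ZMod 2, if z ∈ E then ‖C.finalState y z‖ ^ 2 else 0

/-- A family of circuits is a family of `QNC⁰[⊕]` circuits if it has constant depth and polynomial
size. -/
def IsQNC0Parity (C : (n : ℕ) → QCircuit n) : Prop :=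
  (∃ d : ℕ, ∀ n, (C n).depth ≤ d) ∧ ∃ p : Polynomial ℕ, ∀ n, (C n).size ≤ p.eval n

/-- The enumeration of `𝔽₂ᵏ` by the `2 ^ k` positions of a codeword (binary expansion). -/
def hadamardPoint (k : ℕ) : Fin (2 ^ k) ≃ (Fin k → ZMod 2) :=
  (finFunctionFinEquiv (m := 2) (n := k)).symm

/-- The Hadamard code: `H(x)` has the entry `⟨x, u⟩` at the position of `u ∈ 𝔽₂ᵏ`. -/
def hadamardCode (k : ℕ) (x : Fin k → ZMod 2) : Fin (2 ^ k) → ZMod 2 :=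
  fun j => x ⬝ᵥ hadamardPoint k j

/-- The list of `m` messages of `k` bits that is read off the measurement outcome `z` on output
wires `out`, the `i`-th bit of the `j`-th message being on the wire `out (j, i)`. -/
def readList {W : Type} {m k : ℕ} (out : Fin m × Fin k ↪ W) (z : W → ZMod 2) :
    List (Fin k → ZMod 2) :=
  List.ofFn fun j i => z (out (j, i))

/-! Run `n ^ 2` independent copies of the Bernstein–Vazirani algorithm in parallel. One copy outputs
`x` with probability `(1 - 2 d(y, H x) / n) ^ 2`, which is at least `4 ε ^ 2` for every `x` to be
listed (`le_bvProb`). These probabilities sum to 1 by Parseval (`sum_bvProb`), so at most `1 / (4 ε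
^ 2)` messages must be found. After `m = ⌈ε⁻² log (1/ε)⌉` samples each is missed with probability at
most `(1 - 4 ε ^ 2) ^ m ≤ ε ^ 4`, and a union bound finishes.

The point is to make the query `|u⟩ ↦ (-1) ^ y_u |u⟩` in constant depth. By orthogonality of
characters, `(-1) ^ y_u` is the sum over `a` and `v` of `2⁻ᵏ (-1) ^ ⟨a, v⟩ (-1) ^ (y_a + ⟨u, v⟩)`
(`sum_bvAngle`). Hence the query is, up to a global phase, a product of commuting one-qubit phase
gates on wires that hold the parities `y_a + ⟨u, v⟩`. All these parities are computed at once: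
parity gates conjugated by Hadamard gates fan out the bits (`fanOut_apply`), and one more layer of
parity gates collects them; the same layers then uncompute them. -/

open Finset

/-! ### Product operators on states -/

/-- The operator `⨂ w, K w` on states. -/
noncomputable def tensorOp {W : Type} [Fintype W] [DecidableEq W]
    (K : W → Matrix (ZMod 2) (ZMod 2) ℂ)
    (ψ : QState W) : QState W :=
  fun x => ∑ z : W → ZMod 2, (∏ w, K w (x w) (z w)) * ψ z

section TensorOp

variable {W : Type} [Fintype W] [DecidableEq W]

theorem tensorOp_diagonal (d : W → ZMod 2 → ℂ) (ψ : QState W) :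
    tensorOp (fun w => Matrix.diagonal (d w)) ψ = fun x => (∏ w, d w (x w)) * ψ x := by
  funext x
  unfold tensorOp
  rw [Fintype.sum_eq_single x]
  · simp
  · intro z hz
    obtain ⟨w, hw⟩ := Function.ne_iff.mp hz
    rw [prod_eq_zero (mem_univ w), zero_mul]
    exact Matrix.diagonal_apply_ne _ hw.symm

theorem tensorOp_one (ψ : QState W) : tensorOp (fun _ => 1) ψ = ψ := by
  have h := tensorOp_diagonal (fun _ _ => 1) ψ
  simpa [Matrix.diagonal_one] using h

theorem tensorOp_tensorOp (K K' : W → Matrix (ZMod 2) (ZMod 2) ℂ) (ψ : QState W) :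
    tensorOp K (tensorOp K' ψ) = tensorOp (fun w => K w * K' w) ψ := by
  funext x
  simp only [tensorOp, mul_sum, Matrix.mul_apply]
  rw [sum_comm]
  refine sum_congr rfl fun z _ => ?_
  rw [prod_univ_sum, Fintype.piFinset_univ, sum_mul]
  refine sum_congr rfl fun t _ => ?_
  rw [prod_mul_distrib, mul_assoc]

theorem tensorOp_single (K : W → Matrix (ZMod 2) (ZMod 2) ℂ) (e : W → ZMod 2) :
    tensorOp K (Pi.single e 1) = fun x => ∏ w, K w (x w) (e w) := by
  funext x
  unfold tensorOp
  rw [Fintype.sum_eq_single e]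
  · simp
  · intro z hz
    simp [hz]

theorem one_apply_eq_tensorOp (i : W) (U : Matrix.unitaryGroup (ZMod 2) ℂ) (ψ : QState W) :
    (QGate.one i U).apply ψ =
      tensorOp (Function.update (fun _ => 1) i (U : Matrix (ZMod 2) (ZMod 2) ℂ)) ψ := by
  funext x
  unfold tensorOp
  refine Fintype.sum_of_injective (fun a => Function.update x i a)
    (Function.update_injective x i) _ _ ?_ ?_
  · intro z hz
    have : ∃ w, w ≠ i ∧ x w ≠ z w := by
      by_contra! h
      refine hz ⟨z i, ?_⟩
      funext w
      rcases eq_or_ne w i with rfl | hw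
      · simp
      · simp [hw, h w hw]
    obtain ⟨w, hw, hxz⟩ := this
    rw [prod_eq_zero (mem_univ w), zero_mul]
    simp [hw, hxz]
  · intro a
    rw [← mul_prod_erase univ _ (mem_univ i), prod_eq_one, mul_one]
    · simp
    · intro w hw
      simp [(mem_erase.mp hw).1]

end TensorOp

/-! ### Layers of one-qubit gates and of parity gates -/

/-- The layer that applies the gate `g i` for every `i`. -/
noncomputable def QLayer.ofFamily {W ι : Type} [DecidableEq W] [Fintype ι] (g : ι → QGate W)
    (h : ∀ i j, i ≠ j → Disjoint (g i).support (g j).support) : QLayer W where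
  gates := (univ : Finset ι).toList.map g
  disjoint := List.pairwise_map.mpr
    ((nodup_toList univ).pairwise_of_forall_ne fun i _ j _ hij => h i j hij)

section Layers

theorem QLayer.length_gates_ofFamily {W ι : Type} [DecidableEq W] [Fintype ι]
    (g : ι → QGate W) (h : ∀ i j, i ≠ j → Disjoint (g i).support (g j).support) :
    (QLayer.ofFamily g h).gates.length = Fintype.card ι := by
  simp [QLayer.ofFamily]

variable {W : Type} [DecidableEq W]

/-- The layer with the one-qubit gate `V w` on every wire `w`. -/
noncomputable def localLayer [Fintype W] (V : W → Matrix.unitaryGroup (ZMod 2) ℂ) : QLayer W :=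
  QLayer.ofFamily (fun w => QGate.one w (V w)) fun _ _ h => by
    simpa [QGate.support] using h

theorem localLayer_apply [Fintype W] (V : W → Matrix.unitaryGroup (ZMod 2) ℂ) (ψ : QState W) :
    (localLayer V).apply ψ = tensorOp (fun w => (V w : Matrix (ZMod 2) (ZMod 2) ℂ)) ψ := by
  have key : ∀ l : List W, l.Nodup → ∀ φ : QState W,
      (l.map fun w => QGate.one w (V w)).foldl (fun φ g => g.apply φ) φ =
        tensorOp (fun w => if w ∈ l then (V w : Matrix (ZMod 2) (ZMod 2) ℂ) else 1) φ := by
    intro l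
    induction l with
    | nil => intro _ φ; simp [tensorOp_one]
    | cons i l ih =>
      intro hl φ
      obtain ⟨hi, hl⟩ := List.nodup_cons.mp hl
      rw [List.map_cons, List.foldl_cons, ih hl, one_apply_eq_tensorOp, tensorOp_tensorOp]
      congr 1
      funext w
      rcases eq_or_ne w i with rfl | hw
      · simp [hi]
      · simp [hw]
  have := key univ.toList (nodup_toList univ) ψ
  simpa [QLayer.apply, localLayer, QLayer.ofFamily] using this

/-- The layer with parity gates with inputs `S i` and targets `t i`. -/
noncomputable def parityLayer {ι : Type} [Fintype ι] (S : ι → Finset W) (t : ι → W)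
    (ht : ∀ i, t i ∉ S i)
    (h : ∀ i j, i ≠ j → Disjoint (insert (t i) (S i)) (insert (t j) (S j))) : QLayer W :=
  QLayer.ofFamily (fun i => QGate.parity (S i) (t i) (ht i)) h

theorem parityLayer_length {ι : Type} [Fintype ι] (S : ι → Finset W) (t : ι → W)
    (ht : ∀ i, t i ∉ S i)
    (h : ∀ i j, i ≠ j → Disjoint (insert (t i) (S i)) (insert (t j) (S j))) :
    (parityLayer S t ht h).gates.length = Fintype.card ι :=
  QLayer.length_gates_ofFamily (fun i => QGate.parity (S i) (t i) (ht i)) h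

/-- Since no target lies in the support of another gate, every gate sees the original bits, and the
sequential action has a simultaneous formula. -/
theorem parityLayer_apply {ι : Type} [Fintype ι] [DecidableEq ι] (S : ι → Finset W) (t : ι → W)
    (ht : ∀ i, t i ∉ S i)
    (h : ∀ i j, i ≠ j → Disjoint (insert (t i) (S i)) (insert (t j) (S j)))
    (ψ : QState W) :
    (parityLayer S t ht h).apply ψ =
      fun x => ψ fun w => x w + ∑ i, if t i = w then ∑ s ∈ S i, x s else 0 := by
  have key : ∀ l : List ι, l.Nodup → ∀ φ : QState W,
      (l.map fun i => QGate.parity (S i) (t i) (ht i)).foldl (fun φ g => g.apply φ) φ =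
        fun x => φ fun w => x w + ∑ i ∈ l.toFinset, if t i = w then ∑ s ∈ S i, x s else 0 := by
    intro l
    induction l with
    | nil => intro _ φ; simp
    | cons i l ih =>
      intro hl φ
      obtain ⟨hi, hl⟩ := List.nodup_cons.mp hl
      rw [List.map_cons, List.foldl_cons, ih hl]
      funext x
      have hfix : ∀ w ∈ insert (t i) (S i),
          ∑ j ∈ l.toFinset, (if t j = w then ∑ s ∈ S j, x s else 0) = 0 := by
        intro w hw
        refine sum_eq_zero fun j hj => if_neg ?_
        rintro rfl
        have hij : i ≠ j := by
          rintro rfl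
          exact hi (List.mem_toFinset.mp hj)
        exact disjoint_left.mp (h _ _ hij) hw (mem_insert_self _ _)
      simp only [QGate.apply]
      congr 1
      funext w
      rw [List.toFinset_cons, sum_insert (by simpa using hi)]
      rcases eq_or_ne w (t i) with rfl | hw
      · rw [Function.update_self, hfix _ (mem_insert_self _ _), if_pos rfl, add_zero, add_zero]
        congr 1
        refine sum_congr rfl fun s hs => ?_
        rw [hfix s (mem_insert_of_mem hs), add_zero]
      · rw [Function.update_of_ne hw, if_neg hw.symm, zero_add]
  have := key univ.toList (nodup_toList univ) ψ
  simpa [QLayer.apply, parityLayer, QLayer.ofFamily] using this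

end Layers

/-! ### Signs and characters of `𝔽₂^ι` -/

/-- The sign `(-1) ^ a` of a bit `a`. -/
noncomputable def bitSign (a : ZMod 2) : ℝ := if a = 0 then 1 else -1

@[simp] theorem bitSign_zero : bitSign 0 = 1 := rfl

@[simp] theorem bitSign_one : bitSign 1 = -1 := by simp [bitSign]

theorem bitSign_add (a b : ZMod 2) : bitSign (a + b) = bitSign a * bitSign b := by
  have h : ∀ c : ZMod 2, c = 0 ∨ c = 1 := by decide
  rcases h a with rfl | rfl <;> rcases h b with rfl | rfl <;> simp [CharTwo.add_self_eq_zero]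

theorem bitSign_mul_self (a : ZMod 2) : bitSign a * bitSign a = 1 := by
  rw [← bitSign_add, CharTwo.add_self_eq_zero, bitSign_zero]

theorem bitSign_sum {ι : Type} (s : Finset ι) (f : ι → ZMod 2) :
    bitSign (∑ i ∈ s, f i) = ∏ i ∈ s, bitSign (f i) := by
  classical
  induction s using Finset.induction_on with
  | empty => simp
  | insert i s hi ih => rw [sum_insert hi, prod_insert hi, bitSign_add, ih]

theorem bitSign_mul_bitSign (a b : ZMod 2) :
    bitSign a * bitSign b = 1 - 2 * if a ≠ b then 1 else 0 := by
  rw [← bitSign_add]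
  by_cases h : a = b
  · simp [h, CharTwo.add_self_eq_zero]
  · have : a + b ≠ 0 := fun h0 => h (CharTwo.add_eq_zero.mp h0)
    norm_num [h, bitSign, this]

theorem sum_bitSign_mul (d : ZMod 2) :
    ∑ a : ZMod 2, bitSign (a * d) = if d = 0 then 2 else 0 := by
  rw [show (univ : Finset (ZMod 2)) = {0, 1} from rfl, sum_pair (by decide)]
  by_cases h : d = 0
  · norm_num [h]
  · simp [bitSign, h]

/-- Orthogonality of the characters of `𝔽₂^ι`. -/
theorem sum_bitSign_dotProduct {ι : Type} [Fintype ι] [DecidableEq ι] (d : ι → ZMod 2) :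
    ∑ z : ι → ZMod 2, bitSign (z ⬝ᵥ d) = if d = 0 then 2 ^ Fintype.card ι else 0 := by
  have h : ∏ i, ∑ a : ZMod 2, bitSign (a * d i) = ∑ z : ι → ZMod 2, bitSign (z ⬝ᵥ d) := by
    rw [prod_univ_sum, Fintype.piFinset_univ]
    exact sum_congr rfl fun z _ => (bitSign_sum _ _).symm
  rw [← h]
  simp only [sum_bitSign_mul]
  split_ifs with hd
  · simp [hd]
  · obtain ⟨i, hi⟩ := Function.ne_iff.mp hd
    exact prod_eq_zero (mem_univ i) (if_neg hi)

/-! ### Hadamard and phase gates -/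

/-- The Hadamard matrix. -/
noncomputable def hadMatrix : Matrix (ZMod 2) (ZMod 2) ℂ :=
  fun a b => ((bitSign (a * b) / √2 : ℝ) : ℂ)

/-- The Hadamard gate. -/
noncomputable def hadGate : Matrix.unitaryGroup (ZMod 2) ℂ :=
  ⟨hadMatrix, by
    rw [Matrix.mem_unitaryGroup_iff]
    ext a b
    rw [Matrix.mul_apply]
    have h : ∀ c : ZMod 2, hadMatrix a c * star hadMatrix c b
        = ((bitSign (c * (a + b)) / 2 : ℝ) : ℂ) := by
      intro c
      rw [Matrix.star_apply, hadMatrix, hadMatrix, Complex.star_def, Complex.conj_ofReal,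
        ← Complex.ofReal_mul, div_mul_div_comm, ← bitSign_add, Real.mul_self_sqrt (by norm_num)]
      congr 3
      ring
    simp only [h]
    rw [← Complex.ofReal_sum, ← sum_div, sum_bitSign_mul, Matrix.one_apply]
    by_cases hab : a = b
    · simp [hab, CharTwo.add_self_eq_zero]
    · simp [hab, CharTwo.add_eq_zero]⟩

/-- The phase gate `diag(exp(iθ), exp(-iθ))`. -/
noncomputable def phaseGate (θ : ℝ) : Matrix.unitaryGroup (ZMod 2) ℂ :=
  ⟨Matrix.diagonal fun a => Complex.exp (((θ * bitSign a : ℝ) : ℂ) * Complex.I), by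
    rw [Matrix.mem_unitaryGroup_iff, Matrix.star_eq_conjTranspose, Matrix.diagonal_conjTranspose,
      Matrix.diagonal_mul_diagonal, ← Matrix.diagonal_one]
    congr 1
    funext a
    rw [Pi.star_apply, Complex.star_def, ← Complex.exp_conj, ← Complex.exp_add]
    simp⟩

theorem coe_hadGate : (hadGate : Matrix (ZMod 2) (ZMod 2) ℂ) = hadMatrix := rfl

theorem prod_hadMatrix {ι : Type} [Fintype ι] (x z : ι → ZMod 2) :
    ∏ i, hadMatrix (x i) (z i) = ((bitSign (x ⬝ᵥ z) / √2 ^ Fintype.card ι : ℝ) : ℂ) := by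
  simp only [hadMatrix]
  rw [← Complex.ofReal_prod, prod_div_distrib, dotProduct, bitSign_sum]
  simp

/-- Conjugation by Hadamard gates on all wires turns the pullback along a linear map into
the pullback along the transposed map. -/
theorem tensorOp_hadMatrix_conj {W : Type} [Fintype W] [DecidableEq W]
    (f g : (W → ZMod 2) → (W → ZMod 2)) (hfg : ∀ x z, f x ⬝ᵥ z = x ⬝ᵥ g z)
    (hg : Function.Involutive g) (ψ : QState W) :
    tensorOp (fun _ => hadMatrix) (fun x => tensorOp (fun _ => hadMatrix) ψ (f x)) =
      fun x => ψ (g x) := by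
  funext x
  simp only [tensorOp, prod_hadMatrix, mul_sum]
  rw [sum_comm]
  have h : ∀ t : W → ZMod 2, ∑ z : W → ZMod 2,
      ((bitSign (x ⬝ᵥ z) / √2 ^ Fintype.card W : ℝ) : ℂ) *
        (((bitSign (f z ⬝ᵥ t) / √2 ^ Fintype.card W : ℝ) : ℂ) * ψ t) =
      if t = g x then ψ t else 0 := by
    intro t
    -- Transposing `f` turns the two signs into one character in `z`, whose sum vanishes unless `g t
    -- = x`.
    have h1 : ∀ z : W → ZMod 2, ((bitSign (x ⬝ᵥ z) / √2 ^ Fintype.card W : ℝ) : ℂ) *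
        (((bitSign (f z ⬝ᵥ t) / √2 ^ Fintype.card W : ℝ) : ℂ) * ψ t) =
        ((bitSign (z ⬝ᵥ (x + g t)) / 2 ^ Fintype.card W : ℝ) : ℂ) * ψ t := by
      intro z
      rw [← mul_assoc, ← Complex.ofReal_mul, div_mul_div_comm, ← mul_pow,
        Real.mul_self_sqrt (by norm_num), ← bitSign_add, hfg, dotProduct_comm x z,
        dotProduct_add]
    simp only [h1]
    rw [← sum_mul, ← Complex.ofReal_sum, ← sum_div, sum_bitSign_dotProduct]
    have h2 : x + g t = 0 ↔ t = g x := by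
      rw [funext_iff]
      simp only [Pi.add_apply, Pi.zero_apply, CharTwo.add_eq_zero]
      rw [← funext_iff]
      exact ⟨fun h => by rw [h, hg], fun h => by rw [h, hg]⟩
    simp only [h2]
    split_ifs <;> simp
  simp only [h]
  simp

/-! ### Fan-out by parity gates, and diagonal phases of parities -/

section PhaseCircuit

/-- Source wires `S`, a copy of every source wire for every element of `Q`, and target wires `Q`. -/
abbrev FanWire (S Q : Type) : Type := S ⊕ (S × Q) ⊕ Q

section FanWire

variable {S Q : Type}

/-- The linear map computed by `fanInLayer`. -/
def fanInMap [Fintype Q] (x : FanWire S Q → ZMod 2) : FanWire S Q → ZMod 2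
  | .inl s => x (.inl s) + ∑ q, x (.inr (.inl (s, q)))
  | .inr w => x (.inr w)

/-- Add every source wire to each of its copies. -/
def fanOutMap (x : FanWire S Q → ZMod 2) : FanWire S Q → ZMod 2
  | .inl s => x (.inl s)
  | .inr (.inl (s, q)) => x (.inr (.inl (s, q))) + x (.inl s)
  | .inr (.inr q) => x (.inr (.inr q))

/-- The linear map computed by `collectLayer`. -/
def collectMap (A : Q → Finset S) (x : FanWire S Q → ZMod 2) : FanWire S Q → ZMod 2
  | .inl s => x (.inl s)
  | .inr (.inl p) => x (.inr (.inl p))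
  | .inr (.inr q) => x (.inr (.inr q)) + ∑ s ∈ A q, x (.inr (.inl (s, q)))

theorem fanOutMap_involutive : Function.Involutive (fanOutMap (S := S) (Q := Q)) := by
  intro x
  funext w
  rcases w with s | ⟨s, q⟩ | q <;> simp [fanOutMap, add_assoc, CharTwo.add_self_eq_zero]

theorem collectMap_involutive (A : Q → Finset S) : Function.Involutive (collectMap A) := by
  intro x
  funext w
  rcases w with s | ⟨s, q⟩ | q <;> simp [collectMap, add_assoc, CharTwo.add_self_eq_zero]

/-- Fan-in and fan-out are transposes, the hypothesis needed to exchange them by Hadamard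
conjugation. -/
theorem fanInMap_dotProduct [Fintype S] [Fintype Q] (x z : FanWire S Q → ZMod 2) :
    fanInMap x ⬝ᵥ z = x ⬝ᵥ fanOutMap z := by
  simp only [dotProduct, Fintype.sum_sum_type, fanInMap, fanOutMap, Fintype.sum_prod_type,
    add_mul, mul_add, sum_add_distrib, sum_mul]
  ring

/-- The wires that carry the copies of the source wire `s`. -/
def copiesOf (s : S) : Q ↪ FanWire S Q :=
  ⟨fun q => .inr (.inl (s, q)), fun _ _ h => by simpa using h⟩

/-- The wires that carry the copies of source wires for `q`. -/
def copiesFor (q : Q) : S ↪ FanWire S Q :=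
  ⟨fun s => .inr (.inl (s, q)), fun _ _ h => by simpa using h⟩

@[simp] theorem copiesOf_apply (s : S) (q : Q) : copiesOf s q = .inr (.inl (s, q)) := rfl

@[simp] theorem copiesFor_apply (s : S) (q : Q) : copiesFor q s = .inr (.inl (s, q)) := rfl

variable [DecidableEq S] [Fintype Q] [DecidableEq Q]

/-- Add to the target wire `q` the parity of the copies for `q` of the source wires in `A q`. -/
noncomputable def collectLayer (A : Q → Finset S) : QLayer (FanWire S Q) :=
  parityLayer (ι := Q) (fun q => (A q).map (copiesFor q)) (fun q => Sum.inr (Sum.inr q))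
    (by simp) (by
    intro i j hij
    rw [disjoint_left]
    intro w hi hj
    simp only [mem_insert, mem_map, copiesFor_apply] at hi hj
    rcases hi with rfl | ⟨q, _, rfl⟩ <;> simp_all)

theorem collectLayer_length (A : Q → Finset S) :
    (collectLayer A).gates.length = Fintype.card Q := by
  rw [collectLayer, parityLayer_length]

theorem collectLayer_apply (A : Q → Finset S) (ψ : QState (FanWire S Q)) :
    (collectLayer A).apply ψ = fun x => ψ (collectMap A x) := by
  rw [collectLayer, parityLayer_apply]
  funext x
  congr 1
  funext w
  rcases w with s | p | q <;> simp [collectMap]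

variable [Fintype S]

/-- Add the parity of all copies of a source wire to that wire. -/
noncomputable def fanInLayer (S Q : Type) [Fintype S] [DecidableEq S] [Fintype Q] [DecidableEq Q] :
    QLayer (FanWire S Q) :=
  parityLayer (ι := S) (fun s => univ.map (copiesOf s)) Sum.inl (by simp) (by
    intro i j hij
    rw [disjoint_left]
    intro w hi hj
    simp only [mem_insert, mem_map, mem_univ, true_and, copiesOf_apply] at hi hj
    rcases hi with rfl | ⟨q, rfl⟩ <;> simp_all)

theorem fanInLayer_length : (fanInLayer S Q).gates.length = Fintype.card S := by
  rw [fanInLayer, parityLayer_length]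

theorem fanInLayer_apply (ψ : QState (FanWire S Q)) :
    (fanInLayer S Q).apply ψ = fun x => ψ (fanInMap x) := by
  rw [fanInLayer, parityLayer_apply]
  funext x
  congr 1
  funext w
  rcases w with s | w <;> simp [fanInMap]

/-- Conjugation by Hadamard gates reverses control and target, so unbounded parity yields unbounded
fan-out in three layers. -/
theorem fanOut_apply (ψ : QState (FanWire S Q)) :
    (localLayer fun _ => hadGate).apply ((fanInLayer S Q).apply
      ((localLayer fun _ => hadGate).apply ψ)) = fun x => ψ (fanOutMap x) := by
  simp only [localLayer_apply, fanInLayer_apply, coe_hadGate]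
  exact tensorOp_hadMatrix_conj _ _ fanInMap_dotProduct fanOutMap_involutive ψ

end FanWire

variable {n : ℕ} {U Q : Type}

/-- The basis vector with `y` on the input wires, `b` on `U`, and zeros elsewhere. -/
def phaseBasis (y : Fin n → ZMod 2) (b : U → ZMod 2) : FanWire (Fin n ⊕ U) Q → ZMod 2 :=
  Sum.elim (Sum.elim y b) 0

theorem phaseBasis_injective (y : Fin n → ZMod 2) :
    Function.Injective (phaseBasis (U := U) (Q := Q) y) := by
  intro b c h
  funext u
  exact congrFun h (.inl (.inr u))

/-- Hadamard gates on the wires `U`. -/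
noncomputable def phaseCircuitMix (n : ℕ) (U Q : Type) :
    FanWire (Fin n ⊕ U) Q → Matrix.unitaryGroup (ZMod 2) ℂ
  | .inl (.inr _) => hadGate
  | _ => 1

theorem prod_phaseCircuitMix [Fintype U] [Fintype Q] (y : Fin n → ZMod 2) (b c : U → ZMod 2) :
    ∏ w, (phaseCircuitMix n U Q w : Matrix (ZMod 2) (ZMod 2) ℂ) (phaseBasis y b w)
      (phaseBasis y c w) = ((bitSign (b ⬝ᵥ c) / √2 ^ Fintype.card U : ℝ) : ℂ) := by
  rw [Fintype.prod_sum_type, Fintype.prod_sum_type, ← prod_hadMatrix]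
  simp [phaseCircuitMix, phaseBasis, coe_hadGate]

variable [Fintype U] [DecidableEq U] [Fintype Q] [DecidableEq Q]

/-- The phase gates of angles `θ` on the wires `Q`. -/
noncomputable def phaseCircuitPhase (n : ℕ) (U : Type) {Q : Type} (θ : Q → ℝ) :
    FanWire (Fin n ⊕ U) Q → Matrix.unitaryGroup (ZMod 2) ℂ
  | .inr (.inr q) => phaseGate (θ q)
  | _ => 1

/-- The layers of `phaseCircuit`. -/
noncomputable def phaseCircuitLayers (A : Q → Finset (Fin n ⊕ U)) (θ : Q → ℝ) :
    List (QLayer (FanWire (Fin n ⊕ U) Q)) :=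
  [localLayer (phaseCircuitMix n U Q),
    localLayer fun _ => hadGate, fanInLayer _ _, localLayer fun _ => hadGate,
    collectLayer A, localLayer (phaseCircuitPhase n U θ), collectLayer A,
    localLayer fun _ => hadGate, fanInLayer _ _, localLayer fun _ => hadGate,
    localLayer (phaseCircuitMix n U Q)]

/-- The circuit that applies, between two layers of Hadamard gates on the wires `U`, the diagonal
operator with the phases `∑ q, θ q * (-1) ^ (∑ s ∈ A q, x s)`. -/
noncomputable def phaseCircuit (A : Q → Finset (Fin n ⊕ U)) (θ : Q → ℝ) : QCircuit n where
  Wire := FanWire (Fin n ⊕ U) Q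
  input := ⟨fun i => .inl (.inl i), fun _ _ h => by simpa using h⟩
  layers := phaseCircuitLayers A θ

theorem phaseCircuit_depth (A : Q → Finset (Fin n ⊕ U)) (θ : Q → ℝ) :
    (phaseCircuit A θ).depth = 11 := rfl

/-- The factor 12 counts the wires once and each of the 11 layers at most as often, a layer having
at most one gate per wire. -/
theorem phaseCircuit_size_le (A : Q → Finset (Fin n ⊕ U)) (θ : Q → ℝ) :
    (phaseCircuit A θ).size ≤
      12 * (n + Fintype.card U + (n + Fintype.card U) * Fintype.card Q + Fintype.card Q) := by
  have h1 : (phaseCircuit A θ).size = Fintype.card (FanWire (Fin n ⊕ U) Q) +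
      ((phaseCircuitLayers A θ).map fun L => L.gates.length).sum := rfl
  rw [h1]
  simp only [phaseCircuitLayers, List.map_cons, List.map_nil, List.sum_cons, List.sum_nil,
    localLayer, fanInLayer_length, collectLayer_length, QLayer.length_gates_ofFamily,
    Fintype.card_sum, Fintype.card_prod, Fintype.card_fin]
  generalize (n + Fintype.card U) * Fintype.card Q = p
  omega

theorem phaseCircuit_initBasis (A : Q → Finset (Fin n ⊕ U)) (θ : Q → ℝ) (y : Fin n → ZMod 2) :
    (phaseCircuit A θ).initBasis y = phaseBasis (Q := Q) y (0 : U → ZMod 2) := by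
  funext w
  unfold QCircuit.initBasis
  by_cases h : ∃ i, (phaseCircuit A θ).input i = w
  · obtain ⟨i, rfl⟩ := h
    rw [(phaseCircuit A θ).input.injective.extend_apply]
    rfl
  · rw [Function.extend_apply' _ _ _ h]
    rcases w with (i | u) | w
    · exact absurd ⟨i, rfl⟩ h
    · rfl
    · rfl

/-- Off `U` the mixing layer is the identity, so the superposition it creates is supported on the
vectors `phaseBasis y b`. -/
theorem prod_phaseCircuitMix_eq_zero (y : Fin n → ZMod 2) (c : U → ZMod 2)
    (x : FanWire (Fin n ⊕ U) Q → ZMod 2) (hx : x ∉ Set.range (phaseBasis (U := U) (Q := Q) y)) :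
    ∏ w, (phaseCircuitMix n U Q w : Matrix (ZMod 2) (ZMod 2) ℂ) (x w) (phaseBasis y c w) = 0 := by
  have h : ∃ w, (∀ u, w ≠ .inl (.inr u)) ∧ x w ≠ phaseBasis y c w := by
    by_contra! h
    refine hx ⟨fun u => x (.inl (.inr u)), ?_⟩
    funext w
    rcases w with (i | u) | w
    · exact (h (.inl (.inl i)) (by simp)).symm
    · rfl
    · exact (h (.inr w) (by simp)).symm
  obtain ⟨w, hw, hxw⟩ := h
  refine prod_eq_zero (mem_univ w) ?_
  rcases w with (i | u) | w
  · exact Matrix.one_apply_ne hxw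
  · exact absurd rfl (hw u)
  · exact Matrix.one_apply_ne hxw

theorem phaseCircuitPhase_apply (θ : Q → ℝ) (ψ : QState (FanWire (Fin n ⊕ U) Q)) :
    (localLayer (phaseCircuitPhase n U θ)).apply ψ = fun x =>
      Complex.exp (((∑ q, θ q * bitSign (x (.inr (.inr q))) : ℝ) : ℂ) * Complex.I) * ψ x := by
  rw [localLayer_apply]
  have h : (fun w => (phaseCircuitPhase n U θ w : Matrix (ZMod 2) (ZMod 2) ℂ)) =
      fun w => Matrix.diagonal (match w with
        | .inr (.inr q) => fun a => Complex.exp (((θ q * bitSign a : ℝ) : ℂ) * Complex.I)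
        | _ => fun _ => 1) := by
    funext w
    rcases w with s | p | q
    · simp [phaseCircuitPhase]
    · simp [phaseCircuitPhase]
    · rfl
  rw [h, tensorOp_diagonal]
  funext x
  congr 1
  simp only [Fintype.prod_sum_type, prod_const_one, one_mul]
  rw [← Complex.exp_sum, Complex.ofReal_sum, sum_mul]

/-- Fan-out and collection are involutions, so their second application undoes the first and only
the phase of each branch `b` survives. The two mixing layers contribute `1 / √2` per wire of `U`
each. -/
theorem phaseCircuit_finalState (A : Q → Finset (Fin n ⊕ U)) (θ : Q → ℝ) (y : Fin n → ZMod 2)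
    (t : U → ZMod 2) :
    (phaseCircuit A θ).finalState y (phaseBasis (Q := Q) y t) =
      ∑ b : U → ZMod 2, ((bitSign (t ⬝ᵥ b) / 2 ^ Fintype.card U : ℝ) : ℂ) *
        Complex.exp (((∑ q, θ q * bitSign (∑ s ∈ A q, Sum.elim y b s) : ℝ) : ℂ) * Complex.I) := by
  have h : (phaseCircuit A θ).finalState y =
      (localLayer (phaseCircuitMix n U Q)).apply
      ((localLayer fun _ => hadGate).apply ((fanInLayer _ _).apply
      ((localLayer fun _ => hadGate).apply ((collectLayer A).apply
      ((localLayer (phaseCircuitPhase n U θ)).apply ((collectLayer A).apply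
      ((localLayer fun _ => hadGate).apply ((fanInLayer _ _).apply
      ((localLayer fun _ => hadGate).apply ((localLayer (phaseCircuitMix n U Q)).apply
        (Pi.single (phaseBasis y 0) 1))))))))))) := by
    rw [← phaseCircuit_initBasis A θ y]
    rfl
  rw [h, fanOut_apply, fanOut_apply, phaseCircuitPhase_apply]
  simp only [collectLayer_apply, localLayer_apply, collectMap_involutive A _,
    fanOutMap_involutive _, tensorOp_single]
  unfold tensorOp
  symm
  refine Fintype.sum_of_injective (phaseBasis (U := U) (Q := Q) y) (phaseBasis_injective y) _ _
    ?_ ?_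
  · intro x hx
    beta_reduce
    rw [prod_phaseCircuitMix_eq_zero y 0 x hx, mul_zero, mul_zero]
  · intro b
    have h2 : ∀ q, collectMap A (fanOutMap (phaseBasis (Q := Q) y b)) (.inr (.inr q)) =
        ∑ s ∈ A q, Sum.elim y b s := by
      intro q
      simp [collectMap, fanOutMap, phaseBasis]
    simp only [h2, prod_phaseCircuitMix, dotProduct_zero, bitSign_zero]
    rw [mul_left_comm, mul_comm, ← Complex.ofReal_mul, div_mul_div_comm, ← mul_pow,
      Real.mul_self_sqrt (by norm_num), mul_one]

/-- A lower bound for the probability of an event by the outcomes on the wires `U`. -/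
theorem phaseCircuit_le_prob (A : Q → Finset (Fin n ⊕ U)) (θ : Q → ℝ) (y : Fin n → ZMod 2)
    (E : Set (FanWire (Fin n ⊕ U) Q → ZMod 2)) (T : Finset (U → ZMod 2))
    (hT : ∀ t ∈ T, phaseBasis y t ∈ E) :
    ∑ t ∈ T, ‖(phaseCircuit A θ).finalState y (phaseBasis (Q := Q) y t)‖ ^ 2 ≤
      (phaseCircuit A θ).prob y E := by
  classical
  unfold QCircuit.prob
  rw [← sum_filter]
  rw [← sum_image (g := phaseBasis (U := U) (Q := Q) y)
    (f := fun z => ‖(phaseCircuit A θ).finalState y z‖ ^ 2)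
    ((phaseBasis_injective y).injOn)]
  refine sum_le_sum_of_subset_of_nonneg ?_ fun _ _ _ => by positivity
  intro z hz
  obtain ⟨t, ht, rfl⟩ := mem_image.mp hz
  exact mem_filter.mpr ⟨mem_univ _, hT t ht⟩

end PhaseCircuit

/-! ### The Bernstein–Vazirani algorithm and its constant-depth query -/

section BernsteinVazirani

/-- The probability that the Bernstein–Vazirani algorithm with oracle `y` outputs `x`. -/
noncomputable def bvProb {k : ℕ} (y : Fin (2 ^ k) → ZMod 2) (x : Fin k → ZMod 2) : ℝ :=
  ((∑ u : Fin k → ZMod 2, bitSign (x ⬝ᵥ u) * bitSign (y ((hadamardPoint k).symm u))) / 2 ^ k) ^ 2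

/-- The correlation sum counts agreements minus disagreements of `y` with the codeword of `x`. -/
theorem bvProb_eq {k : ℕ} (y : Fin (2 ^ k) → ZMod 2) (x : Fin k → ZMod 2) :
    bvProb y x = (1 - 2 * ((hammingDist y (hadamardCode k x) : ℝ) / 2 ^ k)) ^ 2 := by
  have h : ∑ u : Fin k → ZMod 2, bitSign (x ⬝ᵥ u) * bitSign (y ((hadamardPoint k).symm u)) =
      2 ^ k - 2 * (hammingDist y (hadamardCode k x) : ℝ) := by
    rw [← (hadamardPoint k).sum_comp]
    simp only [Equiv.symm_apply_apply]
    have h1 : ∀ j, bitSign (x ⬝ᵥ hadamardPoint k j) * bitSign (y j) =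
        1 - 2 * if y j ≠ hadamardCode k x j then 1 else 0 := by
      intro j
      rw [mul_comm, bitSign_mul_bitSign]
      rfl
    simp only [h1]
    rw [sum_sub_distrib, ← mul_sum, sum_boole]
    simp [hammingDist]
  rw [bvProb, h, sub_div, div_self (by positivity), mul_div_assoc]

/-- This is Parseval's identity for the function `(-1) ^ y`. -/
theorem sum_bvProb {k : ℕ} (y : Fin (2 ^ k) → ZMod 2) : ∑ x, bvProb y x = 1 := by
  set f : (Fin k → ZMod 2) → ℝ := fun u => bitSign (y ((hadamardPoint k).symm u)) with hf
  have h1 : ∀ x, bvProb y x =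
      (∑ u, ∑ v, f u * f v * bitSign (x ⬝ᵥ (u + v))) / (2 ^ k * 2 ^ k) := by
    intro x
    rw [bvProb, div_pow, pow_two, pow_two, sum_mul_sum]
    congr 1
    refine sum_congr rfl fun u _ => sum_congr rfl fun v _ => ?_
    rw [dotProduct_add, bitSign_add]
    ring
  simp only [h1]
  rw [← sum_div, sum_comm]
  have h2 : ∀ u : Fin k → ZMod 2, ∑ x : Fin k → ZMod 2, ∑ v, f u * f v * bitSign (x ⬝ᵥ (u + v)) =
      2 ^ k := by
    intro u
    rw [sum_comm]
    simp only [← mul_sum, sum_bitSign_dotProduct]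
    rw [Fintype.sum_eq_single u]
    · have : u + u = 0 := funext fun i => CharTwo.add_self_eq_zero _
      simp [this, hf, bitSign_mul_self]
    · intro v hv
      rw [if_neg, mul_zero]
      intro h
      exact hv (funext fun i => (CharTwo.add_eq_zero.mp (congrFun h i)).symm)
  simp only [h2]
  rw [sum_const, card_univ, Fintype.card_fun, ZMod.card, Fintype.card_fin, nsmul_eq_mul]
  push_cast
  exact div_self (by positivity)

theorem le_bvProb {k : ℕ} {ε : ℝ} (hε : 0 ≤ ε) (y : Fin (2 ^ k) → ZMod 2) (x : Fin k → ZMod 2)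
    (hx : (hammingDist y (hadamardCode k x) : ℝ) ≤ (1 / 2 - ε) * 2 ^ k) :
    4 * ε ^ 2 ≤ bvProb y x := by
  rw [bvProb_eq]
  have h : (hammingDist y (hadamardCode k x) : ℝ) / 2 ^ k ≤ 1 / 2 - ε :=
    (div_le_iff₀ (by positivity)).mpr hx
  nlinarith

/-- The bits `i < k` of the binary expansion of `j`. -/
def binaryPoint (n k : ℕ) (j : Fin n) : Fin k → ZMod 2 :=
  fun i => ((j / 2 ^ (i : ℕ) % 2 : ℕ) : ZMod 2)

/-- The circuit must be defined for every `n`, so its angles use binary digits; they match the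
code's enumeration when `n = 2 ^ k`, the only case that is decoded. -/
theorem binaryPoint_eq (k : ℕ) (j : Fin (2 ^ k)) : binaryPoint (2 ^ k) k j = hadamardPoint k j := by
  funext i
  apply ZMod.val_injective
  rw [binaryPoint, ZMod.val_natCast, Nat.mod_mod]
  rfl

/-- The wires whose parity is `y a + ⟨b r, v⟩`. -/
def bvSources (n k M : ℕ) (q : Fin M × Fin n × (Fin k → ZMod 2)) :
    Finset (Fin n ⊕ (Fin M × Fin k)) :=
  disjSum {q.2.1} ({q.1} ×ˢ univ.filter fun i => q.2.2 i = 1)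

/-- The angles of the phase gates for the query in the Bernstein–Vazirani algorithm. -/
noncomputable def bvAngle (n k M : ℕ) (q : Fin M × Fin n × (Fin k → ZMod 2)) : ℝ :=
  -(Real.pi / 2) / 2 ^ k * bitSign (binaryPoint n k q.2.1 ⬝ᵥ q.2.2)

/-- `M` parallel copies of the Bernstein–Vazirani algorithm for `k`-bit messages. -/
noncomputable def bvCircuit (n k M : ℕ) : QCircuit n :=
  phaseCircuit (bvSources n k M) (bvAngle n k M)

theorem sum_bvSources {n k M : ℕ} (y : Fin n → ZMod 2) (b : Fin M × Fin k → ZMod 2) (r : Fin M)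
    (a : Fin n) (v : Fin k → ZMod 2) :
    ∑ s ∈ bvSources n k M (r, a, v), Sum.elim y b s = y a + (fun i => b (r, i)) ⬝ᵥ v := by
  rw [bvSources, sum_disjSum, sum_singleton, sum_product, sum_singleton, sum_filter]
  congr 1
  refine sum_congr rfl fun i _ => ?_
  have h : ∀ c : ZMod 2, c = 0 ∨ c = 1 := by decide
  rcases h (v i) with h | h <;> simp [h]

/-- For fixed `a`, summing over `v` gives a character sum that selects the position `a` at which
copy `r` queries `y`. -/
theorem sum_bvAngle {k M : ℕ} (y : Fin (2 ^ k) → ZMod 2) (b : Fin M × Fin k → ZMod 2) :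
    ∑ q, bvAngle (2 ^ k) k M q * bitSign (∑ s ∈ bvSources (2 ^ k) k M q, Sum.elim y b s) =
      ∑ r, -(Real.pi / 2) * bitSign (y ((hadamardPoint k).symm fun i => b (r, i))) := by
  rw [Fintype.sum_prod_type]
  refine sum_congr rfl fun r _ => ?_
  rw [Fintype.sum_prod_type]
  set c : Fin k → ZMod 2 := fun i => b (r, i) with hc
  have h1 : ∀ a : Fin (2 ^ k), ∑ v : Fin k → ZMod 2, bvAngle (2 ^ k) k M (r, a, v) *
      bitSign (∑ s ∈ bvSources (2 ^ k) k M (r, a, v), Sum.elim y b s) =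
      if a = (hadamardPoint k).symm c then -(Real.pi / 2) * bitSign (y a) else 0 := by
    intro a
    have h2 : ∀ v : Fin k → ZMod 2, bvAngle (2 ^ k) k M (r, a, v) *
        bitSign (∑ s ∈ bvSources (2 ^ k) k M (r, a, v), Sum.elim y b s) =
        -(Real.pi / 2) / 2 ^ k * bitSign (y a) * bitSign (v ⬝ᵥ (hadamardPoint k a + c)) := by
      intro v
      rw [sum_bvSources, bvAngle, binaryPoint_eq, bitSign_add, dotProduct_add, bitSign_add,
        dotProduct_comm v, dotProduct_comm v]
      ring
    simp only [h2]
    rw [← mul_sum, sum_bitSign_dotProduct]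
    have h3 : hadamardPoint k a + c = 0 ↔ a = (hadamardPoint k).symm c := by
      rw [Equiv.eq_symm_apply, funext_iff, funext_iff]
      simp only [Pi.add_apply, Pi.zero_apply, CharTwo.add_eq_zero]
    simp only [h3, Fintype.card_fin]
    split_ifs
    · field_simp
    · simp
  simp only [h1]
  simp

/-- The angle `π / 2` turns a sign in the exponent into a sign factor, up to the global phase `-i`.
-/
theorem exp_neg_pi_div_two_mul_bitSign (a : ZMod 2) :
    Complex.exp (((-(Real.pi / 2) * bitSign a : ℝ) : ℂ) * Complex.I) =
      -Complex.I * (bitSign a : ℂ) := by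
  unfold bitSign
  split_ifs
  · rw [mul_one]
    push_cast
    rw [Complex.exp_mul_I, Complex.cos_neg, Complex.sin_neg, Complex.cos_pi_div_two,
      Complex.sin_pi_div_two]
    simp
  · rw [mul_neg_one, neg_neg]
    push_cast
    rw [Complex.exp_mul_I, Complex.cos_pi_div_two, Complex.sin_pi_div_two]
    simp

/-- Phases and characters both split over the copies, so the amplitude factorises and the outcomes
are independent samples. -/
theorem bvCircuit_finalState {k M : ℕ} (y : Fin (2 ^ k) → ZMod 2) (t : Fin M × Fin k → ZMod 2) :
    ‖(bvCircuit (2 ^ k) k M).finalState y (phaseBasis y t)‖ ^ 2 =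
      ∏ r, bvProb y fun i => t (r, i) := by
  have h : (bvCircuit (2 ^ k) k M).finalState y (phaseBasis y t) =
      ∏ r, ∑ u : Fin k → ZMod 2, (((bitSign ((fun i => t (r, i)) ⬝ᵥ u) *
        bitSign (y ((hadamardPoint k).symm u)) / 2 ^ k : ℝ) : ℂ) * -Complex.I) := by
    refine (phaseCircuit_finalState (bvSources (2 ^ k) k M) (bvAngle (2 ^ k) k M) y t).trans ?_
    rw [prod_univ_sum, Fintype.piFinset_univ,
      ← (Equiv.curry (Fin M) (Fin k) (ZMod 2)).sum_comp]
    refine sum_congr rfl fun b _ => ?_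
    rw [sum_bvAngle, Complex.ofReal_sum, sum_mul, Complex.exp_sum]
    simp only [exp_neg_pi_div_two_mul_bitSign]
    have h1 : bitSign (t ⬝ᵥ b) / 2 ^ Fintype.card (Fin M × Fin k) =
        ∏ r : Fin M, bitSign ((fun i => t (r, i)) ⬝ᵥ fun i => b (r, i)) / 2 ^ k := by
      rw [prod_div_distrib, ← bitSign_sum, dotProduct, Fintype.sum_prod_type]
      simp [dotProduct, ← pow_mul, mul_comm]
    rw [h1, Complex.ofReal_prod, ← prod_mul_distrib]
    refine prod_congr rfl fun r _ => ?_
    have hb : Equiv.curry (Fin M) (Fin k) (ZMod 2) b r = fun i => b (r, i) := rfl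
    rw [hb]
    push_cast
    ring
  rw [h, norm_prod, ← prod_pow]
  refine prod_congr rfl fun r _ => ?_
  rw [← sum_mul, ← Complex.ofReal_sum, ← sum_div, norm_mul, norm_neg, Complex.norm_I, mul_one,
    Complex.norm_real, Real.norm_eq_abs, sq_abs, bvProb]

end BernsteinVazirani

/-! ### Collecting all likely elements by independent sampling -/

/-- If `M ≥ m` independent samples are drawn from a distribution `p`, then with probability at least
`1 - |G| (1 - δ)ᵐ` the first `m` of them contain all elements of `G`, each of which has probability
at least `δ`. -/
theorem le_sum_prod_of_forall_exists {X : Type} [Fintype X] [DecidableEq X] (p : X → ℝ)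
    (hp : ∀ x, 0 ≤ p x) (hsum : ∑ x, p x = 1) (G : Finset X) (δ : ℝ)
    (hG : ∀ x ∈ G, δ ≤ p x) {m M : ℕ} (hm : m ≤ M) (P : (Fin M → X) → Prop) [DecidablePred P]
    (hP : ∀ t, (∀ x ∈ G, ∃ j : Fin m, t (Fin.castLE hm j) = x) → P t) :
    1 - #G * (1 - δ) ^ m ≤ ∑ t with P t, ∏ r, p (t r) := by
  have htotal : ∑ t : Fin M → X, ∏ r, p (t r) = 1 := by
    rw [← Fintype.piFinset_univ, ← prod_univ_sum]
    simp [hsum]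
  have hmiss : ∀ x ∈ G, ∑ t : Fin M → X,
      (if ∀ j : Fin m, t (Fin.castLE hm j) ≠ x then ∏ r, p (t r) else 0) ≤ (1 - δ) ^ m := by
    intro x hx
    -- Deleting the mass of `x` in the first `m` coordinates keeps the product form, so the sum
    -- factorises into `m` factors `1 - p x` and ones.
    have h1 : ∀ t : Fin M → X,
        (if ∀ j : Fin m, t (Fin.castLE hm j) ≠ x then ∏ r, p (t r) else 0) =
        ∏ r : Fin M, if (r : ℕ) < m ∧ t r = x then 0 else p (t r) := by
      intro t
      split_ifs with h
      · refine prod_congr rfl fun r _ => ?_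
        rw [if_neg]
        rintro ⟨hr, hrx⟩
        exact h ⟨r, hr⟩ hrx
      · push Not at h
        obtain ⟨j, hj⟩ := h
        symm
        refine prod_eq_zero (mem_univ (Fin.castLE hm j)) ?_
        exact if_pos ⟨j.2, hj⟩
    simp only [h1]
    rw [← Fintype.piFinset_univ,
      ← prod_univ_sum (fun _ => univ) fun (r : Fin M) z => if (r : ℕ) < m ∧ z = x then 0 else p z]
    have h2 : ∀ r : Fin M, ∑ z, (if (r : ℕ) < m ∧ z = x then 0 else p z) =
        if (r : ℕ) < m then 1 - p x else 1 := by
      intro r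
      split_ifs with hr
      · simp only [hr, true_and]
        rw [← hsum, ← add_sum_erase univ p (mem_univ x), add_sub_cancel_left,
          ← add_sum_erase univ _ (mem_univ x), if_pos rfl, zero_add]
        exact sum_congr rfl fun z hz => if_neg (ne_of_mem_erase hz)
      · simp [hr, hsum]
    simp only [h2]
    rw [Fin.prod_univ_eq_prod_range (fun r => if r < m then 1 - p x else 1) M,
      ← prod_subset (range_subset_range.mpr hm), prod_congr rfl fun r hr =>
        if_pos (mem_range.mp hr), prod_const, card_range]
    · have hpx : p x ≤ 1 := hsum ▸ single_le_sum (fun z _ => hp z) (mem_univ x)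
      exact pow_le_pow_left₀ (by linarith) (by linarith [hG x hx]) m
    · intro r _ hr
      exact if_neg fun h => hr (mem_range.mpr h)
  -- The union bound, stated pointwise: a tuple outside `P` misses some element of `G`.
  have hcover : ∀ t : Fin M → X, ∏ r, p (t r) ≤ (if P t then ∏ r, p (t r) else 0) +
      ∑ x ∈ G, if ∀ j : Fin m, t (Fin.castLE hm j) ≠ x then ∏ r, p (t r) else 0 := by
    intro t
    have h0 : 0 ≤ ∏ r, p (t r) := prod_nonneg fun r _ => hp _
    have h1 : ∀ x ∈ G, 0 ≤ if ∀ j : Fin m, t (Fin.castLE hm j) ≠ x then ∏ r, p (t r) else 0 := by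
      intro x _
      split_ifs
      exacts [h0, le_rfl]
    by_cases ht : P t
    · rw [if_pos ht]
      exact le_add_of_nonneg_right (sum_nonneg h1)
    · have hx : ∃ x ∈ G, ∀ j : Fin m, t (Fin.castLE hm j) ≠ x := by
        by_contra! h
        exact ht (hP t h)
      obtain ⟨x, hxG, hx⟩ := hx
      rw [if_neg ht, zero_add]
      exact (if_pos hx).symm.le.trans (single_le_sum h1 hxG)
  have h := sum_le_sum fun t (_ : t ∈ (univ : Finset (Fin M → X))) => hcover t
  rw [htotal, sum_add_distrib, sum_comm, ← sum_filter] at h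
  have h2 := sum_le_sum hmiss
  rw [sum_const, nsmul_eq_mul] at h2
  linarith

/-! ### Circuit size, list length and failure probability -/

theorem bvCircuit_size_le (n : ℕ) : (bvCircuit n (Nat.log 2 n) (n ^ 2)).size ≤
    12 * (n + n ^ 2 * n + (n + n ^ 2 * n) * (n ^ 2 * (n * (n + 1))) + n ^ 2 * (n * (n + 1))) := by
  have hk : Nat.log 2 n ≤ n := Nat.log_le_self 2 n
  -- The summand 1 is needed only for `n = 0`, where `Nat.log` takes the value 0.
  have hpow : 2 ^ Nat.log 2 n ≤ n + 1 := by
    rcases eq_or_ne n 0 with rfl | hn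
    · simp
    · exact (Nat.pow_log_le_self 2 hn).trans n.le_succ
  refine (phaseCircuit_size_le _ _).trans ?_
  simp only [Fintype.card_prod, Fintype.card_fin, Fintype.card_fun, ZMod.card]
  gcongr

/-- The number of samples that the list decoder reads. -/
noncomputable def listLength (ε : ℝ) : ℕ := ⌈ε⁻¹ ^ 2 * Real.log (1 / ε)⌉₊

/-- For `ε ≤ 1 / 2` the quantity being rounded is at least 1, so the ceiling costs at most a factor
2. -/
theorem listLength_le_two_mul {ε : ℝ} (h0 : 0 < ε) (h1 : ε ≤ 1 / 2) :
    (listLength ε : ℝ) ≤ 2 * (ε⁻¹ ^ 2 * Real.log (1 / ε)) := by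
  have h2 : 2 ≤ ε⁻¹ := by
    rw [le_inv_comm₀ (by norm_num) h0]
    linarith
  have h3 : 1 / 2 ≤ Real.log (1 / ε) := by
    rw [one_div ε]
    have := Real.log_le_log (by norm_num) h2
    linarith [Real.log_two_gt_d9]
  have h4 : 1 ≤ ε⁻¹ ^ 2 * Real.log (1 / ε) := by nlinarith
  have := Nat.ceil_lt_add_one (zero_le_one.trans h4)
  rw [listLength]
  linarith

/-- Both factors `ε⁻²` and `log (1/ε)` are at most `n`. Thus `n ^ 2` copies serve all admissible
`ε`, and the circuit need not depend on `ε`. -/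
theorem listLength_le {ε : ℝ} {n : ℕ} (h0 : 0 < ε) (h1 : ε ≤ 1 / 2) (hn : ε⁻¹ ^ 2 ≤ n) :
    listLength ε ≤ n ^ 2 := by
  have h2 : 2 ≤ ε⁻¹ := by
    rw [le_inv_comm₀ (by norm_num) h0]
    linarith
  have h3 : Real.log (1 / ε) ≤ n := by
    rw [one_div]
    have := Real.log_le_sub_one_of_pos (inv_pos.mpr h0)
    nlinarith
  have h4 : 0 ≤ Real.log (1 / ε) := Real.log_nonneg (by rw [one_div]; linarith)
  rw [listLength, Nat.ceil_le, Nat.cast_pow, pow_two (n : ℝ)]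
  gcongr

/-- From `1 - t ≤ exp (-t)` and the choice of length, the power is at most `ε ^ 4`, which absorbs `N
≤ 1 / (4 ε ^ 2)`. -/
theorem card_mul_one_sub_pow_le {ε N : ℝ} (h0 : 0 < ε) (h1 : ε ≤ 1 / 2)
    (hN : N * (4 * ε ^ 2) ≤ 1) : N * (1 - 4 * ε ^ 2) ^ listLength ε ≤ ε := by
  have h2 : (1 - 4 * ε ^ 2) ^ listLength ε ≤ ε ^ 4 := by
    have hm : ε⁻¹ ^ 2 * Real.log (1 / ε) ≤ listLength ε := Nat.le_ceil _
    calc (1 - 4 * ε ^ 2) ^ listLength ε ≤ Real.exp (-(4 * ε ^ 2)) ^ listLength ε := by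
          refine pow_le_pow_left₀ (by nlinarith) ?_ _
          linarith [Real.add_one_le_exp (-(4 * ε ^ 2))]
      _ = Real.exp (listLength ε * -(4 * ε ^ 2)) := (Real.exp_nat_mul _ _).symm
      _ ≤ Real.exp (4 * Real.log ε) := by
          rw [Real.exp_le_exp]
          have h : ε⁻¹ ^ 2 * Real.log (1 / ε) * (4 * ε ^ 2) = -(4 * Real.log ε) := by
            rw [one_div, Real.log_inv]
            field_simp
          nlinarith [mul_le_mul_of_nonneg_right hm (by positivity : 0 ≤ 4 * ε ^ 2)]
      _ = ε ^ 4 := by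
          rw [show (4 : ℝ) = ((4 : ℕ) : ℝ) by norm_num, Real.exp_nat_mul, Real.exp_log h0]
  have h3 : 0 ≤ (1 - 4 * ε ^ 2) ^ listLength ε := pow_nonneg (by nlinarith) _
  rcases le_total N 0 with h | h
  · nlinarith
  · calc N * (1 - 4 * ε ^ 2) ^ listLength ε ≤ N * ε ^ 4 := by gcongr
      _ ≤ ε := by nlinarith [mul_le_mul_of_nonneg_right hN (sq_nonneg ε)]

/-! ### List decoding by the circuit family -/

/-- The output wires of the first `m` copies of the Bernstein–Vazirani algorithm. -/
def bvOutput {n k m M : ℕ} (hm : m ≤ M) : Fin m × Fin k ↪ (bvCircuit n k M).Wire :=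
  ⟨fun p => .inl (.inr (Fin.castLE hm p.1, p.2)), fun p q h => by
    have h' := Sum.inr_injective (Sum.inl_injective h)
    simpa [Prod.ext_iff] using h'⟩

theorem bvCircuit_listDecode {k M : ℕ} {ε : ℝ} (h0 : 0 < ε) (h1 : ε ≤ 1 / 2)
    (hm : listLength ε ≤ M) (y : Fin (2 ^ k) → ZMod 2) :
    1 - ε ≤ (bvCircuit (2 ^ k) k M).prob y
      {z | ∀ x : Fin k → ZMod 2, (hammingDist y (hadamardCode k x) : ℝ) ≤ (1 / 2 - ε) * 2 ^ k →
        x ∈ readList (bvOutput hm) z} := by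
  classical
  set G : Finset (Fin k → ZMod 2) := univ.filter fun x =>
    (hammingDist y (hadamardCode k x) : ℝ) ≤ (1 / 2 - ε) * 2 ^ k with hG
  have hGp : ∀ x ∈ G, 4 * ε ^ 2 ≤ bvProb y x := fun x hx =>
    le_bvProb h0.le y x (mem_filter.mp hx).2
  have hp : ∀ x, 0 ≤ bvProb y x := fun x => sq_nonneg _
  -- The list-size bound: elements of probability at least `4 ε ^ 2` number at most `1 / (4 ε ^ 2)`.
  have hcard : (#G : ℝ) * (4 * ε ^ 2) ≤ 1 := by
    rw [← nsmul_eq_mul, ← sum_const, ← sum_bvProb y]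
    exact (sum_le_sum hGp).trans
      (sum_le_sum_of_subset_of_nonneg (subset_univ _) fun x _ _ => hp x)
  set P : (Fin M → Fin k → ZMod 2) → Prop := fun t =>
    ∀ x ∈ G, ∃ j : Fin (listLength ε), t (Fin.castLE hm j) = x with hP
  have h := le_sum_prod_of_forall_exists (bvProb y) hp (sum_bvProb y) G (4 * ε ^ 2)
    hGp hm P fun t ht => ht
  have hout : ∀ t ∈ univ.filter (fun t : Fin M × Fin k → ZMod 2 => P fun r i => t (r, i)),
      phaseBasis y t ∈ {z : (bvCircuit (2 ^ k) k M).Wire → ZMod 2 | ∀ x : Fin k → ZMod 2,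
        (hammingDist y (hadamardCode k x) : ℝ) ≤ (1 / 2 - ε) * 2 ^ k →
        x ∈ readList (bvOutput hm) z} := by
    intro t ht x hx
    obtain ⟨j, hj⟩ := (mem_filter.mp ht).2 x (mem_filter.mpr ⟨mem_univ _, hx⟩)
    exact (List.mem_ofFn' _ _).mpr ⟨j, hj⟩
  have hprob := phaseCircuit_le_prob (bvSources (2 ^ k) k M) (bvAngle (2 ^ k) k M) y _ _ hout
  have hsum : ∑ t with P t, ∏ r, bvProb y (t r) =
      ∑ t : Fin M × Fin k → ZMod 2 with P fun r i => t (r, i),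
        ‖(bvCircuit (2 ^ k) k M).finalState y (phaseBasis y t)‖ ^ 2 := by
    rw [sum_filter, sum_filter, ← (Equiv.curry (Fin M) (Fin k) (ZMod 2)).sum_comp]
    refine sum_congr rfl fun t _ => ?_
    rw [bvCircuit_finalState]
    rfl
  have := card_mul_one_sub_pow_le h0 h1 hcard
  rw [hsum] at h
  exact le_trans (by linarith) (h.trans hprob)

theorem corollary2p3 :
    ∃ C : (n : ℕ) → QCircuit n, IsQNC0Parity C ∧
      ∃ K : ℝ, 0 < K ∧
        ∀ (k : ℕ) (ε : ℝ), 1 / √((2 : ℝ) ^ k) ≤ ε → ε ≤ 1 / 2 →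
          ∃ m : ℕ, (m : ℝ) ≤ K * (ε⁻¹ ^ 2 * Real.log (1 / ε)) ∧
            ∃ out : Fin m × Fin k ↪ (C (2 ^ k)).Wire,
              ∀ y : Fin (2 ^ k) → ZMod 2,
                1 - ε ≤ (C (2 ^ k)).prob y
                  {z | ∀ x : Fin k → ZMod 2,
                    (hammingDist y (hadamardCode k x) : ℝ) ≤ (1 / 2 - ε) * 2 ^ k →
                      x ∈ readList out z} := by
  refine ⟨fun n => bvCircuit n (Nat.log 2 n) (n ^ 2), ⟨⟨11, fun n => (phaseCircuit_depth _ _).le⟩, ?_⟩, 2, two_pos, ?_⟩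
  · open Polynomial in
    refine ⟨12 * (X + X ^ 2 * X + (X + X ^ 2 * X) * (X ^ 2 * (X * (X + 1))) +
      X ^ 2 * (X * (X + 1))), fun n => (bvCircuit_size_le n).trans (le_of_eq ?_)⟩
    simp
  · intro k ε hk h1
    have hpos : 0 < 1 / √((2 : ℝ) ^ k) := by positivity
    have h0 : 0 < ε := hpos.trans_le hk
    have hn : ε⁻¹ ^ 2 ≤ ((2 ^ k : ℕ) : ℝ) := by
      have h := pow_le_pow_left₀ (inv_nonneg.mpr h0.le) (inv_anti₀ hpos hk) 2
      rw [one_div, inv_inv, Real.sq_sqrt (by positivity)] at h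
      exact_mod_cast h
    have hm := listLength_le h0 h1 hn
    refine ⟨listLength ε, listLength_le_two_mul h0 h1, ?_⟩
    -- The wire type depends on `Nat.log 2 (2 ^ k)`; generalising it to `k'` allows substitution
    -- instead of a transport of types.
    have hlog : ∀ k', k' = k → ∃ out : Fin (listLength ε) × Fin k ↪
        (bvCircuit (2 ^ k) k' ((2 ^ k) ^ 2)).Wire, ∀ y : Fin (2 ^ k) → ZMod 2,
          1 - ε ≤ (bvCircuit (2 ^ k) k' ((2 ^ k) ^ 2)).prob y {z | ∀ x : Fin k → ZMod 2,
            (hammingDist y (hadamardCode k x) : ℝ) ≤ (1 / 2 - ε) * 2 ^ k →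
              x ∈ readList out z} := by
      rintro _ rfl
      exact ⟨bvOutput hm, bvCircuit_listDecode h0 h1 hm⟩
    exact hlog _ (Nat.log_pow one_lt_two k)
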